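/- Let $(\Omega,\mathcal F,\mathcal F_t,X_t,\theta_t,\mathbb P_x)$ be a time homogeneous strong Markov process with càdlàg paths on $\mathbb R^d$ whose filtration satisfies the usual conditions. Write $P_t(x,A):=\mathbb P_x(X_t\in A)$ and let $\lambda$ be Lebesgue measure on $\mathbb R^d$; all sets $A$ below are Borel. The process is called *$\lambda$-irreducible* if $\lambda(A)>0$ implies $\mathbb E_x\bigl(\int_0^\infty 1_A(X_t)\,dt\bigr)>0$ for all $x$. It is called a *$T$-model* if there are a probability measure $\mu$ on $[0,\infty)$ and a kernel $T(x,A)$ on $\mathbb R^d$ with $T(x,\mathbb R^d)>0$ for all $x$, with $x\mapsto T(x,A)$ lower semicontinuous for every $A$, and with $\int_0^\infty \mathbb E_x(1_A(X_t))\,\mu(dt)\ge T(x,A)$ for all $x$ and $A$. **Theorem.** (i) If $$\lambda(A)>0\ \Rightarrow\ P_t(x,A)>0\quad\text{for all } t>0,\ x\in\mathbb R^d, \tag{1}$$ then the process is $\lambda$-irreducible. (ii) If (1) holds and there is a nonempty compact set $K\subset[0,\infty)$ such that for every compact set $C\subset\mathbb R^d$ there is a nonzero measure $\nu$ on $\mathbb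 R^d$ (which may depend on $C$; in particular, one $\nu$ for all $C$ is allowed) with $$\inf_{t\in K}\inf_{x\in C}P_t(x,A)\ \ge\ \nu(A)\quad\text{for all Borel sets } A, \tag{2}$$ then the process is a $\lambda$-irreducible $T$-model. (iii) Suppose that for all $t>0$ and $x$ the measure $P_t(x,\cdot)$ is the sum of a (possibly trivial) discrete measure, that is, one carried by a countable set, and a measure with a (sub-probability) density $\tilde p_t(x,\cdot)$ with respect to $\lambda$, such that $\tilde p_t(x,y)>0$ for all $x,y\in\mathbb R^d$ and $t>0$, and $\inf_{t\in[1,2]}\inf_{x\in C}\tilde p_t(x,y)>0$ for all $y\in\mathbb R^d$ and all compact sets $C\subset\mathbb R^d$. Then the hypotheses of (ii) hold; in particular the process is a $\lambda$-irreducible $T$-model. -/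

import Mathlib

open MeasureTheory ProbabilityTheory Set Filter Topology
open scoped NNReal ENNReal

/-- The state space `ℝ^d`, with its Euclidean norm, Borel σ-algebra and Lebesgue measure `volume`. -/
abbrev StateSpace (d : ℕ) : Type := EuclideanSpace ℝ (Fin d)

/-- A time homogeneous strong Markov process `(Ω, 𝓕, 𝓕_t, X_t, θ_t, P_x)` with càdlàg paths in
`ℝ^d`, whose filtration satisfies the usual conditions. The time set is `[0, ∞)`. -/
structure StrongMarkovProcess (d : ℕ) (Ω : Type*) [mΩ : MeasurableSpace Ω] where
  /-- the filtration `(𝓕_t)` -/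
  filt : Filtration ℝ≥0 mΩ
  /-- the position `X_t` at time `t` -/
  X : ℝ≥0 → Ω → StateSpace d
  /-- the shift operators -/
  shift : ℝ≥0 → Ω → Ω
  /-- the law `P_x` of the process started in `x` -/
  P : StateSpace d → Measure Ω
  isProbabilityMeasure : ∀ x, IsProbabilityMeasure (P x)
  /-- The process under `P_x` starts in `x`. -/
  start : ∀ x, P x {ω | X 0 ω = x} = 1
  adapted : ∀ t, Measurable[filt t] (X t)
  X_shift : ∀ s t ω, X s (shift t ω) = X (t + s) ω
  right_continuous : ∀ ω t, ContinuousWithinAt (fun s => X s ω) (Ici t) t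
  left_limits : ∀ ω t, ∃ l, Tendsto (fun s => X s ω) (𝓝[<] t) (𝓝 l)
  /-- Usual conditions: the filtration is right-continuous, ... -/
  filt_right_continuous : ∀ t s, (∀ u, t < u → MeasurableSet[filt u] s) → MeasurableSet[filt t] s
  /-- ... and it contains every subset of an event that is null under all the laws `P_x`. -/
  filt_complete : ∀ N B : Set Ω, N ⊆ B → MeasurableSet B → (∀ x, P x B = 0) →
    MeasurableSet[filt 0] N
  /-- The transition probabilities depend measurably on the starting point. -/
  measurable_transition : ∀ t (A : Set (StateSpace d)), MeasurableSet A →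
    Measurable fun x => P x (X t ⁻¹' A)
  /-- Strong Markov property: for every stopping time `τ` with values in `[0, ∞]`,
  `P_x(X_{τ + t} ∈ A | 𝓕_τ) = P_{X_τ}(X_t ∈ A)` holds `P_x`-almost surely on `{τ < ∞}`. -/
  strong_markov : ∀ (τ : Ω → WithTop ℝ≥0) (hτ : IsStoppingTime filt τ) (x : StateSpace d)
    (t : ℝ≥0) (A : Set (StateSpace d)) (L : Set Ω), MeasurableSet A →
    MeasurableSet[hτ.measurableSpace] L →
    P x (L ∩ {ω | τ ω ≠ ⊤ ∧ X ((τ ω).untopD 0 + t) ω ∈ A}) =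
      ∫⁻ ω in L ∩ {ω | τ ω ≠ ⊤}, P (X ((τ ω).untopD 0) ω) (X t ⁻¹' A) ∂(P x)

namespace StrongMarkovProcess

variable {d : ℕ} {Ω : Type*} [MeasurableSpace Ω]

/-- The transition probability `P_t(x, A) = P_x(X_t ∈ A)`, as a measure in `A`. -/
noncomputable def transition (Z : StrongMarkovProcess d Ω) (t : ℝ≥0) (x : StateSpace d) :
    Measure (StateSpace d) :=
  (Z.P x).map (Z.X t)

/-- `λ`-irreducibility: if `λ(A) > 0`, then `E_x (∫_0^∞ 1_A(X_t) dt) > 0` for all `x`. -/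
def IsLebesgueIrreducible (Z : StrongMarkovProcess d Ω) : Prop :=
  ∀ A : Set (StateSpace d), MeasurableSet A → 0 < volume A → ∀ x,
    0 < ∫⁻ ω, (∫⁻ t in Ici (0 : ℝ), A.indicator (fun _ => (1 : ℝ≥0∞)) (Z.X t.toNNReal ω)) ∂(Z.P x)

/-- `T`-model: the process sampled at a random time with some law `μ` on `[0, ∞)` dominates a
kernel `T` with `T(x, ℝ^d) > 0` for all `x` such that each `T(·, A)` is lower semicontinuous. -/
def IsTModel (Z : StrongMarkovProcess d Ω) : Prop :=
  ∃ (μ : Measure ℝ≥0) (T : Kernel (StateSpace d) (StateSpace d)), IsProbabilityMeasure μ ∧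
    (∀ x, 0 < T x univ) ∧
    (∀ A, MeasurableSet A → LowerSemicontinuous fun x => T x A) ∧
    ∀ x A, MeasurableSet A →
      T x A ≤ ∫⁻ t, (∫⁻ ω, A.indicator (fun _ => (1 : ℝ≥0∞)) (Z.X t ω) ∂(Z.P x)) ∂μ

/-- If `λ(A) > 0`, then `P_t(x, A) > 0` for all `t > 0` and all `x`. -/
def ChargesLebesgue (Z : StrongMarkovProcess d Ω) : Prop :=
  ∀ A : Set (StateSpace d), MeasurableSet A → 0 < volume A →
    ∀ t : ℝ≥0, 0 < t → ∀ x, 0 < Z.transition t x A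

/-- There is a nonempty compact set `K ⊆ [0, ∞)` of times such that for every compact `C ⊆ ℝ^d`
the transition probabilities `P_t(x, ·)`, `t ∈ K`, `x ∈ C`, have a common nontrivial minorant. -/
def IsMinorizedOnCompacts (Z : StrongMarkovProcess d Ω) : Prop :=
  ∃ K : Set ℝ≥0, IsCompact K ∧ K.Nonempty ∧
    ∀ C : Set (StateSpace d), IsCompact C → ∃ ν : Measure (StateSpace d), ν ≠ 0 ∧
      ∀ A, MeasurableSet A → ν A ≤ ⨅ t ∈ K, ⨅ x ∈ C, Z.transition t x A

/-- For `t > 0`, `P_t(x, ·)` is the sum of a (possibly trivial) discrete measure, i.e. one that is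
carried by a countable set, and a measure with density `p t x` with respect to `λ`. The densities
are positive, and bounded away from `0` locally uniformly in `x` and uniformly in `t ∈ [1, 2]`. -/
def HasPositiveDensityPart (Z : StrongMarkovProcess d Ω) : Prop :=
  ∃ (D : ℝ≥0 → StateSpace d → Measure (StateSpace d))
    (p : ℝ≥0 → StateSpace d → StateSpace d → ℝ≥0∞),
    (∀ t, 0 < t → ∀ x, Measurable (p t x) ∧
      (∃ S : Set (StateSpace d), S.Countable ∧ D t x Sᶜ = 0) ∧
      Z.transition t x = D t x + volume.withDensity (p t x)) ∧
    (∀ t, 0 < t → ∀ x y, 0 < p t x y) ∧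
    ∀ C : Set (StateSpace d), IsCompact C → ∀ y,
      0 < ⨅ t ∈ Icc (1 : ℝ≥0) 2, ⨅ x ∈ C, p t x y

end StrongMarkovProcess

/-! Irreducibility is Tonelli: the expected occupation time of `A` is the time integral of `P_t(x,
A)`, whose integrand is positive for `t > 0`; right-continuity of paths supplies the joint
measurability. For the `T`-model a single time `t₀ ∈ K` suffices, with `μ` the Dirac mass there. The
minorants of the balls of radius `n` are glued into one kernel, lower semicontinuous in `x`. For
(iii), the natural minorant has as density the infimum of all `p t x`, but an uncountable infimum
need not be measurable. A countable subfamily with the same essential infimum replaces it. -/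

/-- A right-continuous process with measurable time marginals is jointly measurable. -/
theorem measurable_uncurry_of_right_continuous {Ω E : Type*} [MeasurableSpace Ω]
    [TopologicalSpace E] [TopologicalSpace.PseudoMetrizableSpace E] [MeasurableSpace E]
    [BorelSpace E] {X : ℝ≥0 → Ω → E} (hX : ∀ t, Measurable (X t))
    (hc : ∀ ω t, ContinuousWithinAt (fun s => X s ω) (Ici t) t) :
    Measurable (Function.uncurry X) := by
  -- Times are rounded up to the grid of mesh `1 / (n + 1)`: the approximants have countably many
  -- values and converge from the right.
  have hlim : ∀ t : ℝ≥0, Tendsto (fun n : ℕ => (⌈t * (n + 1)⌉₊ : ℝ≥0) / (n + 1)) atTop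
      (𝓝[Ici t] t) := by
    intro t
    refine tendsto_nhdsWithin_iff.2 ⟨?_, Eventually.of_forall fun n => ?_⟩
    · have h : Tendsto (fun n : ℕ => t + 1 / ((n : ℝ≥0) + 1)) atTop (𝓝 t) := by
        simpa using (tendsto_const_nhds (x := t)).add
          (tendsto_one_div_add_atTop_nhds_zero_nat (𝕜 := ℝ≥0))
      refine tendsto_of_tendsto_of_tendsto_of_le_of_le tendsto_const_nhds h (fun n => ?_)
        fun n => ?_
      · exact (le_div_iff₀ (by positivity)).2 (Nat.le_ceil _)
      · refine (div_le_iff₀ (by positivity)).2 ((Nat.ceil_lt_add_one (a := t * (n + 1)) zero_le).le.trans ?_)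
        rw [add_mul, one_div, inv_mul_cancel₀ (Nat.cast_add_one_ne_zero n)]
    · exact mem_Ici.2 ((le_div_iff₀ (by positivity)).2 (Nat.le_ceil _))
  refine measurable_of_tendsto_metrizable
    (f := fun (n : ℕ) (q : ℝ≥0 × Ω) => X ((⌈q.1 * (n + 1)⌉₊ : ℝ≥0) / (n + 1)) q.2)
    (fun n => ?_) (tendsto_pi_nhds.2 fun q => (hc q.2 q.1).tendsto.comp (hlim q.1))
  have h : Measurable fun q : ℕ × Ω => X ((q.1 : ℝ≥0) / (n + 1)) q.2 :=
    measurable_from_prod_countable_right fun k => hX ((k : ℝ≥0) / (n + 1))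
  exact h.comp (((Nat.measurable_ceil.comp (measurable_fst.mul_const _))).prodMk measurable_snd)

/-- A family of measurable functions with finite integrals has a countable subfamily whose infimum
is an essential lower bound of the whole family. -/
theorem exists_seq_iInf_ae_le {α ι : Type*} [MeasurableSpace α] [Nonempty ι] {μ : Measure α}
    {f : ι → α → ℝ≥0∞} (hf : ∀ i, Measurable (f i)) (hfin : ∀ i, ∫⁻ a, f i a ∂μ ≠ ∞) :
    ∃ s : ℕ → ι, ∀ i, (fun a => ⨅ n, f (s n) a) ≤ᵐ[μ] f i := by
  -- Minimise the integral of the infimum over all countable subfamilies; pairing indices merges a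
  -- minimising sequence of subfamilies into one.
  obtain ⟨u, -, hu, hmem⟩ := exists_seq_tendsto_sInf
    (range_nonempty fun s : ℕ → ι => ∫⁻ a, ⨅ n, f (s n) a ∂μ) (OrderBot.bddBelow _)
  choose s hs using hmem
  refine ⟨fun k => s k.unpair.1 k.unpair.2, fun i => ?_⟩
  set r : ℕ → ι := fun k => s k.unpair.1 k.unpair.2
  have hr : Measurable fun a => ⨅ n, f (r n) a := .iInf fun n => hf _
  -- Adjoining `i` to the minimiser cannot lower the integral, so the infimum is unchanged almost
  -- everywhere.
  let r' : ℕ → ι := fun k => Nat.casesOn k i r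
  have hle : ∀ a, ⨅ n, f (r' n) a ≤ ⨅ n, f (r n) a := fun a =>
    le_iInf fun n => iInf_le (fun n => f (r' n) a) (n + 1)
  have hmin : ∫⁻ a, ⨅ n, f (r n) a ∂μ ≤ ∫⁻ a, ⨅ n, f (r' n) a ∂μ := by
    refine le_trans (ge_of_tendsto' hu fun n => ?_) (sInf_le ⟨r', rfl⟩)
    rw [← hs n]
    refine lintegral_mono fun a => le_iInf fun m => ?_
    simpa [r] using iInf_le (fun n => f (r n) a) (Nat.pair n m)
  have heq := ae_eq_of_ae_le_of_lintegral_le (μ := μ) (Eventually.of_forall hle)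
    (ne_top_of_le_ne_top (hfin i) (lintegral_mono fun a => iInf_le (fun n => f (r' n) a) 0))
    hr.aemeasurable hmin
  filter_upwards [heq] with a ha
  exact ha.symm.le.trans (iInf_le (fun n => f (r' n) a) 0)

namespace StrongMarkovProcess

variable {d : ℕ} {Ω : Type*} [MeasurableSpace Ω] (Z : StrongMarkovProcess d Ω)

theorem measurable_X (t : ℝ≥0) : Measurable (Z.X t) :=
  (Z.adapted t).mono (Z.filt.le t) le_rfl

theorem lintegral_indicator_X (t : ℝ≥0) (x : StateSpace d) {A : Set (StateSpace d)}
    (hA : MeasurableSet A) :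
    ∫⁻ ω, A.indicator (fun _ => (1 : ℝ≥0∞)) (Z.X t ω) ∂(Z.P x) = Z.transition t x A := by
  rw [transition, ← lintegral_map (f := A.indicator fun _ => (1 : ℝ≥0∞))
    (measurable_one.indicator hA) (Z.measurable_X t)]
  exact lintegral_indicator_one hA

theorem isProbabilityMeasure_transition (t : ℝ≥0) (x : StateSpace d) :
    IsProbabilityMeasure (Z.transition t x) :=
  have := Z.isProbabilityMeasure x
  Measure.isProbabilityMeasure_map (Z.measurable_X t).aemeasurable

variable {Z}

theorem ChargesLebesgue.isLebesgueIrreducible (h : Z.ChargesLebesgue) :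
    Z.IsLebesgueIrreducible := by
  intro A hA hvol x
  have := Z.isProbabilityMeasure x
  have hm : Measurable fun q : Ω × ℝ =>
      A.indicator (fun _ => (1 : ℝ≥0∞)) (Z.X q.2.toNNReal q.1) :=
    (measurable_one.indicator hA).comp
      ((measurable_uncurry_of_right_continuous Z.measurable_X Z.right_continuous).comp
        (measurable_snd.real_toNNReal.prodMk measurable_fst))
  rw [lintegral_lintegral_swap hm.aemeasurable]
  simp only [Z.lintegral_indicator_X _ x hA]
  have hm' : Measurable fun t : ℝ => Z.transition t.toNNReal x A := by
    simpa only [Z.lintegral_indicator_X _ x hA] using hm.lintegral_prod_left' (μ := Z.P x)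
  rw [setLIntegral_pos_iff hm']
  -- The open interval avoids `t = 0`, where positivity is not assumed.
  refine lt_of_lt_of_le ?_ (measure_mono (s := Ioo (0 : ℝ) 1) fun t ht =>
    ⟨(h A hA hvol t.toNNReal (Real.toNNReal_pos.2 ht.1) x).ne', ht.1.le⟩)
  simp

theorem IsMinorizedOnCompacts.isTModel (h : Z.IsMinorizedOnCompacts) : Z.IsTModel := by
  obtain ⟨K, -, ⟨t₀, ht₀⟩, hK⟩ := h
  choose ν hν0 hν using fun n : ℕ =>
    hK (Metric.closedBall 0 n) (isCompact_closedBall 0 (n : ℝ))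
  have hle : ∀ n : ℕ, ∀ x ∈ Metric.ball (0 : StateSpace d) n, ∀ A, MeasurableSet A →
      ν n A ≤ Z.transition t₀ x A := fun n x hx A hA =>
    (hν n A hA).trans ((iInf₂_le t₀ ht₀).trans (iInf₂_le x (Metric.ball_subset_closedBall hx)))
  classical
  -- Indicators of open balls are lower semicontinuous, and the weights sum to `1`, which keeps `T
  -- x` below the transition law at `t₀`.
  let T : Kernel (StateSpace d) (StateSpace d) := Kernel.sum fun n : ℕ =>
    Kernel.piecewise (Metric.isOpen_ball (x := 0) (ε := n)).measurableSet
      (Kernel.const _ ((2⁻¹ : ℝ≥0∞) ^ (n + 1) • ν n)) 0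
  have hT : ∀ x A, MeasurableSet A → T x A = ∑' n : ℕ,
      (Metric.ball (0 : StateSpace d) n).indicator
        (fun _ => (2⁻¹ : ℝ≥0∞) ^ (n + 1) * ν n A) x := by
    intro x A hA
    rw [Kernel.sum_apply' _ _ hA]
    refine tsum_congr fun n => ?_
    by_cases hx : x ∈ Metric.ball (0 : StateSpace d) n <;>
      simp only [Kernel.piecewise_apply, hx, if_true, if_false, indicator_of_mem,
        indicator_of_notMem, not_false_eq_true, Kernel.const_apply, _root_.zero_apply,
        Measure.smul_apply, smul_eq_mul, Measure.coe_zero, Pi.zero_apply]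
  refine ⟨Measure.dirac t₀, T, inferInstance, fun x => ?_, fun A hA => ?_, fun x A hA => ?_⟩
  · obtain ⟨n, hn⟩ := exists_nat_gt ‖x‖
    rw [hT x univ .univ]
    refine lt_of_lt_of_le ?_ (ENNReal.le_tsum n)
    rw [indicator_of_mem (by simpa using hn)]
    exact ENNReal.mul_pos (by simp) (by simpa using hν0 n)
  · simp only [hT _ A hA]
    exact lowerSemicontinuous_tsum fun n =>
      Metric.isOpen_ball.lowerSemicontinuous_indicator zero_le
  · simp only [Z.lintegral_indicator_X _ x hA, lintegral_dirac]
    rw [hT x A hA]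
    calc _ ≤ ∑' n : ℕ, (2⁻¹ : ℝ≥0∞) ^ (n + 1) * Z.transition t₀ x A := by
          refine ENNReal.tsum_le_tsum fun n => indicator_apply_le' (fun hx => ?_) fun _ => zero_le
          exact mul_le_mul_right (hle n x hx A hA) _
      _ = Z.transition t₀ x A := by
          rw [ENNReal.tsum_mul_right, ENNReal.tsum_geometric_add_one, ENNReal.one_sub_inv_two,
            inv_inv, ENNReal.inv_mul_cancel (by simp) (by simp), one_mul]

theorem HasPositiveDensityPart.chargesLebesgue (h : Z.HasPositiveDensityPart) :
    Z.ChargesLebesgue := by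
  obtain ⟨D, p, hp, hpos, -⟩ := h
  intro A hA hvol t ht x
  obtain ⟨hm, -, heq⟩ := hp t ht x
  rw [heq, Measure.add_apply, withDensity_apply _ hA]
  refine lt_of_lt_of_le ?_ le_add_self
  rw [setLIntegral_pos_iff hm]
  refine hvol.trans_le (measure_mono fun y hy => ⟨(hpos t ht x y).ne', hy⟩)

theorem HasPositiveDensityPart.isMinorizedOnCompacts (h : Z.HasPositiveDensityPart) :
    Z.IsMinorizedOnCompacts := by
  obtain ⟨D, p, hp, -, hinf⟩ := h
  refine ⟨Icc 1 2, isCompact_Icc, ⟨1, by norm_num⟩, fun C hC => ?_⟩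
  rcases C.eq_empty_or_nonempty with rfl | ⟨x₀, hx₀⟩
  -- An infimum over the empty set is `∞`, so any nonzero measure will do.
  · exact ⟨volume, NeZero.ne _, fun A _ => by simp⟩
  let ι := Icc (1 : ℝ≥0) 2 × C
  have : Nonempty ι := ⟨⟨1, by norm_num⟩, ⟨x₀, hx₀⟩⟩
  have ht : ∀ i : ι, 0 < (i.1 : ℝ≥0) := fun i => zero_lt_one.trans_le i.1.2.1
  have hm : ∀ i : ι, Measurable (p i.1 i.2) := fun i => (hp _ (ht i) _).1
  have hle : ∀ i : ι, volume.withDensity (p i.1 i.2) ≤ Z.transition i.1 i.2 := fun i => by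
    rw [(hp _ (ht i) _).2.2]
    exact Measure.le_add_left le_rfl
  have hfin : ∀ i : ι, ∫⁻ y, p i.1 i.2 y ≠ ∞ := fun i => by
    have := Z.isProbabilityMeasure_transition i.1 i.2
    have h := hle i univ
    rw [withDensity_apply _ .univ, Measure.restrict_univ] at h
    exact ne_top_of_le_ne_top (measure_ne_top _ _) h
  obtain ⟨s, hs⟩ := exists_seq_iInf_ae_le (μ := volume) hm hfin
  have hg : Measurable fun y => ⨅ n, p (s n).1 (s n).2 y := .iInf fun n => hm _
  -- The countable infimum dominates the full one, hence is positive everywhere.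
  have hgpos : ∀ y, 0 < ⨅ n, p (s n).1 (s n).2 y := fun y =>
    (hinf C hC y).trans_le (le_iInf fun n =>
      (iInf₂_le _ (s n).1.2).trans (iInf₂_le _ (s n).2.2))
  refine ⟨volume.withDensity fun y => ⨅ n, p (s n).1 (s n).2 y, fun h0 => ?_, fun A hA => ?_⟩
  · rw [withDensity_eq_zero_iff hg.aemeasurable] at h0
    obtain ⟨y, hy⟩ := h0.exists
    exact (hgpos y).ne' hy
  · exact le_iInf₂ fun t ht => le_iInf₂ fun x hx =>
      (withDensity_mono (hs (⟨t, ht⟩, ⟨x, hx⟩)) A).trans (hle (⟨t, ht⟩, ⟨x, hx⟩) A)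

end StrongMarkovProcess

theorem mainTheorem9 {d : ℕ} {Ω : Type*} [MeasurableSpace Ω] (Z : StrongMarkovProcess d Ω) :
    (Z.ChargesLebesgue → Z.IsLebesgueIrreducible) ∧
    (Z.ChargesLebesgue → Z.IsMinorizedOnCompacts → Z.IsLebesgueIrreducible ∧ Z.IsTModel) ∧
    (Z.HasPositiveDensityPart →
      (Z.ChargesLebesgue ∧ Z.IsMinorizedOnCompacts) ∧ Z.IsLebesgueIrreducible ∧ Z.IsTModel) :=
  ⟨fun h => h.isLebesgueIrreducible, fun h h' => ⟨h.isLebesgueIrreducible, h'.isTModel⟩,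
    fun h => ⟨⟨h.chargesLebesgue, h.isMinorizedOnCompacts⟩,
      h.chargesLebesgue.isLebesgueIrreducible, h.isMinorizedOnCompacts.isTModel⟩⟩
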